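/- An oriented virtual knot diagram $K$ is described by its signed Gauss code: the cyclic word of passages met while traversing the knot once, where $O_c$, $U_c$ denote the over- and underpass of the classical crossing $c$ and $V_v$ (occurring twice) a passage through the virtual crossing $v$, together with a sign $\pm1$ for each classical crossing. Its bracket polynomial is $$\langle K\rangle=\sum_{s}A^{c(s)}d^{\,|s|-1}\in\mathbb Z[A,A^{-1}],\qquad d=-A^{2}-A^{-2},$$ where $s$ runs over the states, i.e. the choices of an $\alpha$- or $\beta$-smoothing at each classical crossing (the $\alpha$-smoothing is the orientation-respecting one at a positive crossing and the other one at a negative crossing), $c(s)$ is the number of $\alpha$- minus the number of $\beta$-smoothings, and $|s|$ is the number of closed curves of $s$ (curves run straight through virtual crossings). The writhe $w(K)$ is the sum of the signs of the classical crossings. The fundamental group $\pi_1(K)$ is given by the Wirtinger presentation: generators are the arcs of the diagram between classical crossings (passing through virtual crossings), the two overcrossing arcs $o$ at a crossing of sign $\varepsilon$ are identified, and the incoming and outgoing undercrossing arcs $u,u'$ satisfy $u'=o^{-\varepsilon}u\,o^{\varepsilon}$. For $t\in\mathbb Z$ put $n=|t|$ and let $K_m(t)$ be the virtual knot diagram with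 classical crossings $0,1,\dots,5+n$, virtual crossings $0,1$ and Gauss code $$U_0\,O_3\,V_0\;\;X_6X_7\cdots X_{5+n}\;\;L_n\;\;\overline X_{5+n}\cdots \overline X_7\overline X_6\;\;V_0\,O_2\,U_1\;\;U_4\,V_1\,O_5\,O_4\,V_1\,U_5 .$$ Here $X_6,X_7,\dots$ are alternately over- and underpasses, beginning with an overpass if $t>0$ and with an underpass if $t<0$; $\overline X_k$ is the other passage of crossing $k$; and $L_n=O_0O_1U_2U_3$ if $n$ is even, $L_n=U_3U_2O_1O_0$ if $n$ is odd. The crossings $6,\dots,5+n$ (the $n$ inserted half twists) have the sign of $t$; crossings $0,3$ have sign $(-1)^n$ and crossings $1,2$ sign $-(-1)^n$; crossing $4$ is negative and crossing $5$ is positive. **Theorem.** For every $t\in\mathbb Z$, $$\langle K_m(t)\rangle=(-A)^{3t}=(-1)^tA^{3t},$$ so that the normalized bracket polynomial satisfies $(-A^{3})^{-w(K_m(t))}\langle K_m(t)\rangle=1$, the value for the unknot; and $\pi_1(K_m(t))\cong\mathbb Z$, the fundamental group of the unknot. -/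

import Mathlib

open LaurentPolynomial

/-- One passage of the knot through a crossing: over or under the classical crossing with label `c`,
or through the virtual crossing with label `v`. -/
inductive Passage where
  | over (c : ℕ)
  | under (c : ℕ)
  | virt (v : ℕ)
  deriving DecidableEq

/-- An oriented virtual knot diagram, given by its signed Gauss code.  Starting from a base point
that is not a crossing, `word` lists the passages met while the knot is traversed once along its
orientation.  Every classical crossing is passed once over and once under, every virtual crossing
is passed twice.  `sign c` is the sign of the classical crossing `c` (its value at a label that
does not occur is irrelevant). -/
structure VirtualKnotDiagram where
  word : List Passage
  sign : ℕ → ℤˣ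
  over_count : ∀ c, word.count (Passage.over c) ≤ 1
  under_count : ∀ c, word.count (Passage.under c) = word.count (Passage.over c)
  virt_count : ∀ v, word.count (Passage.virt v) = 0 ∨ word.count (Passage.virt v) = 2

namespace VirtualKnotDiagram

/-- The passages, numbered along the knot. -/
abbrev Pos (K : VirtualKnotDiagram) : Type := Fin K.word.length

/-- The edges of the diagram cut at its base point.  Passage `i` leads from the edge `i.castSucc`
to the edge `i.succ`; the first edge `0` and the last edge `Fin.last _` meet at the base point. -/
abbrev Edge (K : VirtualKnotDiagram) : Type := Fin (K.word.length + 1)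

/-- The classical crossings. -/
def crossings (K : VirtualKnotDiagram) : Finset ℕ :=
  (K.word.filterMap fun
    | Passage.over c => some c
    | _ => none).toFinset

/-- How the ends of the edges are joined in the state in which the classical crossings in `S` have
a type `α` smoothing and the others a type `β` smoothing.  At a positive crossing the type `α`
smoothing respects the orientation and the type `β` smoothing does not; at a negative crossing it
is the other way round. -/
inductive Joined (K : VirtualKnotDiagram) (S : Finset ℕ) : K.Edge → K.Edge → Prop
  | base : Joined K S (Fin.last _) 0
  | virt (i : K.Pos) (v : ℕ) (hi : K.word.get i = Passage.virt v) :
      Joined K S i.castSucc i.succ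
  | oriented_over (c : ℕ) (i j : K.Pos) (hi : K.word.get i = Passage.over c)
      (hj : K.word.get j = Passage.under c) (h : c ∈ S ↔ K.sign c = 1) :
      Joined K S i.castSucc j.succ
  | oriented_under (c : ℕ) (i j : K.Pos) (hi : K.word.get i = Passage.over c)
      (hj : K.word.get j = Passage.under c) (h : c ∈ S ↔ K.sign c = 1) :
      Joined K S j.castSucc i.succ
  | unoriented_in (c : ℕ) (i j : K.Pos) (hi : K.word.get i = Passage.over c)
      (hj : K.word.get j = Passage.under c) (h : ¬(c ∈ S ↔ K.sign c = 1)) :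
      Joined K S i.castSucc j.castSucc
  | unoriented_out (c : ℕ) (i j : K.Pos) (hi : K.word.get i = Passage.over c)
      (hj : K.word.get j = Passage.under c) (h : ¬(c ∈ S ↔ K.sign c = 1)) :
      Joined K S i.succ j.succ

/-- The number `|s|` of closed curves of a state: the classes of edges under the equivalence
relation generated by `Joined`. -/
noncomputable def curves (K : VirtualKnotDiagram) (S : Finset ℕ) : ℕ :=
  Nat.card (Quot (K.Joined S))

/-- The bracket polynomial `∑ A ^ c(s) * d ^ (|s| - 1)` with `d = -A⁻² - A²`; here `A` is the
variable `T 1`, and `c(s)` is the number of type `α` minus the number of type `β` smoothings. -/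
noncomputable def bracket (K : VirtualKnotDiagram) : ℤ[T;T⁻¹] :=
  ∑ S ∈ K.crossings.powerset,
    T ((S.card : ℤ) - ((K.crossings \ S).card : ℤ)) * (-T (-2) - T 2) ^ (K.curves S - 1)

/-- The writhe: the sum of the signs of the classical crossings. -/
def writhe (K : VirtualKnotDiagram) : ℤ :=
  ∑ c ∈ K.crossings, (K.sign c : ℤ)

/-- The normalized bracket polynomial `(-A³) ^ (-w) ⟨K⟩`, where `w` is the writhe. -/
noncomputable def normalizedBracket (K : VirtualKnotDiagram) : ℤ[T;T⁻¹] :=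
  C ((Int.negOnePow K.writhe : ℤˣ) : ℤ) * T (-3 * K.writhe) * K.bracket

/-- The relators of the fundamental group.  A label does not change at the base point, at a virtual
crossing and along an overpass; at an underpass it is conjugated by the label of the overpass. -/
inductive IsRelator (K : VirtualKnotDiagram) : FreeGroup K.Edge → Prop
  | base : IsRelator K (FreeGroup.of (Fin.last _) * (FreeGroup.of 0)⁻¹)
  | virt (i : K.Pos) (v : ℕ) (hi : K.word.get i = Passage.virt v) :
      IsRelator K (FreeGroup.of i.succ * (FreeGroup.of i.castSucc)⁻¹)
  | over (i : K.Pos) (c : ℕ) (hi : K.word.get i = Passage.over c) :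
      IsRelator K (FreeGroup.of i.succ * (FreeGroup.of i.castSucc)⁻¹)
  | under (c : ℕ) (i j : K.Pos) (hi : K.word.get i = Passage.over c)
      (hj : K.word.get j = Passage.under c) :
      IsRelator K (FreeGroup.of j.succ *
        (FreeGroup.of i.castSucc ^ (-(K.sign c : ℤ)) * FreeGroup.of j.castSucc *
          FreeGroup.of i.castSucc ^ (K.sign c : ℤ))⁻¹)

/-- The fundamental group of a virtual knot diagram (Wirtinger presentation). -/
abbrev fundamentalGroup (K : VirtualKnotDiagram) : Type :=
  PresentedGroup {r | K.IsRelator r}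

end VirtualKnotDiagram

/-- Two antiparallel strands are twisted around each other with the `n` crossings
`6, 7, …, 5 + n`: the passages of the strand that meets them in this order, alternately over and
under, starting over if `b` and under otherwise. -/
def twistForth (b : Bool) (n : ℕ) : List Passage :=
  (List.range n).map fun k =>
    if Even k ↔ b = true then Passage.over (6 + k) else Passage.under (6 + k)

/-- The passages of the other strand, which meets the same crossings in the opposite order. -/
def twistBack (b : Bool) (n : ℕ) : List Passage :=
  ((List.range n).map fun k =>
    if Even k ↔ b = true then Passage.under (6 + k) else Passage.over (6 + k)).reverse

/-- The end loop of the twisted band; an odd number of half twists reverses its direction. -/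
def endLoop (n : ℕ) : List Passage :=
  if Even n then [Passage.over 0, Passage.over 1, Passage.under 2, Passage.under 3]
  else [Passage.under 3, Passage.under 2, Passage.over 1, Passage.over 0]

/-- The Gauss word of `K_m(t)`, where `n = |t|`, and `b` says whether `0 < t`.  The last line is
the left half (half of Kishino's knot: classical crossings `4`, `5` and virtual crossing `1`), the
rest is the right half: a band of two antiparallel strands that crosses itself in the virtual
crossing `0`, runs through `n` half twists, and ends in a loop around the band (classical
crossings `0, 1, 2, 3`). -/
def kmWord (b : Bool) (n : ℕ) : List Passage :=
  [Passage.under 0, Passage.over 3, Passage.virt 0] ++ twistForth b n ++ endLoop n ++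
    twistBack b n ++ [Passage.virt 0, Passage.over 2, Passage.under 1] ++
    [Passage.under 4, Passage.virt 1, Passage.over 5, Passage.over 4, Passage.virt 1,
      Passage.under 5]

/-- The signs of the crossings of `K_m(t)`. -/
def kmSign (b : Bool) (n : ℕ) : ℕ → ℤˣ
  | 0 => if Even n then 1 else -1
  | 1 => if Even n then -1 else 1
  | 2 => if Even n then -1 else 1
  | 3 => if Even n then 1 else -1
  | 4 => -1
  | 5 => 1
  | _ => if b then 1 else -1

theorem twist_count_over (b : Bool) (n c : ℕ) :
    (twistForth b n).count (Passage.over c) + (twistBack b n).count (Passage.over c) =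
      if 6 ≤ c ∧ c < 6 + n then 1 else 0 := by
  simp only [twistForth, twistBack, List.count_reverse]
  induction n with
  | zero => simp
  | succ n ih =>
    simp only [List.range_succ, List.map_append, List.count_append, List.map_cons, List.map_nil]
    by_cases h : (Even n ↔ b = true) <;> by_cases hc : 6 + n = c <;>
      simp [h, hc] <;> split_ifs at ih ⊢ <;> omega

theorem twist_count_under (b : Bool) (n c : ℕ) :
    (twistForth b n).count (Passage.under c) + (twistBack b n).count (Passage.under c) =
      if 6 ≤ c ∧ c < 6 + n then 1 else 0 := by
  simp only [twistForth, twistBack, List.count_reverse]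
  induction n with
  | zero => simp
  | succ n ih =>
    simp only [List.range_succ, List.map_append, List.count_append, List.map_cons, List.map_nil]
    by_cases h : (Even n ↔ b = true) <;> by_cases hc : 6 + n = c <;>
      simp [h, hc] <;> split_ifs at ih ⊢ <;> omega

theorem twist_count_virt (b : Bool) (n v : ℕ) :
    (twistForth b n).count (Passage.virt v) = 0 ∧ (twistBack b n).count (Passage.virt v) = 0 := by
  constructor <;> rw [List.count_eq_zero] <;> simp only [twistForth, twistBack, List.mem_reverse,
    List.mem_map, not_exists, not_and] <;> intro k _ <;> split_ifs <;> simp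

theorem kmWord_count_over (b : Bool) (n c : ℕ) :
    (kmWord b n).count (Passage.over c) = if c < 6 + n then 1 else 0 := by
  have h := twist_count_over b n c
  rcases Nat.lt_or_ge c 6 with hc | hc
  · rw [if_pos (by omega : c < 6 + n)]
    interval_cases c <;> by_cases hn : Even n <;>
      simp [kmWord, endLoop, hn] at h ⊢ <;> omega
  · have e : (endLoop n).count (Passage.over c) = 0 := by
      rw [List.count_eq_zero]; unfold endLoop; split_ifs <;> simp <;> omega
    simp only [kmWord, List.count_append, List.count_cons, List.count_nil, e]
    simp [show ¬ 3 = c by omega, show ¬ 2 = c by omega, show ¬ 5 = c by omega,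
      show ¬ 4 = c by omega, h, hc]

theorem kmWord_count_under (b : Bool) (n c : ℕ) :
    (kmWord b n).count (Passage.under c) = if c < 6 + n then 1 else 0 := by
  have h := twist_count_under b n c
  rcases Nat.lt_or_ge c 6 with hc | hc
  · rw [if_pos (by omega : c < 6 + n)]
    interval_cases c <;> by_cases hn : Even n <;>
      simp [kmWord, endLoop, hn] at h ⊢ <;> omega
  · have e : (endLoop n).count (Passage.under c) = 0 := by
      rw [List.count_eq_zero]; unfold endLoop; split_ifs <;> simp <;> omega
    simp only [kmWord, List.count_append, List.count_cons, List.count_nil, e]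
    simp [show ¬ 0 = c by omega, show ¬ 1 = c by omega, show ¬ 5 = c by omega,
      show ¬ 4 = c by omega, h, hc]

theorem kmWord_count_virt (b : Bool) (n v : ℕ) :
    (kmWord b n).count (Passage.virt v) = if v < 2 then 2 else 0 := by
  have e : (endLoop n).count (Passage.virt v) = 0 := by
    rw [List.count_eq_zero]; unfold endLoop; split_ifs <;> simp
  obtain ⟨h1, h2⟩ := twist_count_virt b n v
  simp only [kmWord, List.count_append, List.count_cons, List.count_nil, e, h1, h2]
  rcases v with _ | _ | v <;> simp

/-- The virtual knot diagram `K_m(t)`, with `|t|` half twists whose crossings have the sign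
of `t`. -/
def Km (t : ℤ) : VirtualKnotDiagram where
  word := kmWord (decide (0 < t)) t.natAbs
  sign := kmSign (decide (0 < t)) t.natAbs
  over_count c := by rw [kmWord_count_over]; split_ifs <;> omega
  under_count c := by rw [kmWord_count_over, kmWord_count_under]
  virt_count v := by rw [kmWord_count_virt]; split_ifs <;> simp

/-!
The state sum of `K_m(t)` splits into the smoothings of the half twists and those of the crossings
`0, …, 5`. If no half twist is smoothed with its orientation, the band runs straight through all of
them; otherwise it is cut, and `j` oriented smoothings add `j - 1` circles between them. In both
cases three Reidemeister moves of the second kind, on the pairs `4, 5`, then `0, 1`, then `2, 3`,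
undo the crossings `0, …, 5` and leave one curve if the band is straight and two if it is cut, so
that they contribute `d ^ j` altogether. By the binomial theorem the bracket is
`(A ^ ε * d + A ^ (-ε)) ^ |t| = (-A ^ (3 * ε)) ^ |t|`, where `ε` is the sign of `t`.

In the fundamental group, the left half of the diagram gives equal labels to all its edges. The arc
that passes over the crossings `0` and `1` has opposite signs there, so the two strands of the band
have the same label, whatever the label of that arc. Each half twist then preserves this label, so
that the arc has it too, and all labels agree.
-/

section StateSum

variable {ι : Type*} [DecidableEq ι] {X : Finset ι} {c : Finset ι → ℕ}

/-- The value `d = -A⁻² - A²` of a closed curve in the bracket polynomial. -/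
noncomputable def loopValue : ℤ[T;T⁻¹] := -T (-2) - T 2

/-- The bracket state sum over the smoothings of the crossings in `X`, where `c S` is the number of
closed curves of the state in which exactly the crossings in `S` have a type `α` smoothing. -/
noncomputable def stateSum (X : Finset ι) (c : Finset ι → ℕ) : ℤ[T;T⁻¹] :=
  ∑ S ∈ X.powerset, T ((S.card : ℤ) - ((X \ S).card : ℤ)) * loopValue ^ (c S - 1)

theorem stateSum_empty : stateSum ∅ c = loopValue ^ (c ∅ - 1) := by
  simp [stateSum]

theorem stateSum_congr {c' : Finset ι → ℕ} (h : ∀ S ⊆ X, c S = c' S) :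
    stateSum X c = stateSum X c' :=
  Finset.sum_congr rfl fun S hS => by rw [h S (Finset.mem_powerset.1 hS)]

theorem stateSum_insert {a : ι} (ha : a ∉ X) :
    stateSum (insert a X) c =
      T (-1) * stateSum X c + T 1 * stateSum X fun S => c (insert a S) := by
  simp only [stateSum, Finset.sum_powerset_insert ha, Finset.mul_sum, ← mul_assoc, ← T_add]
  congr 1 <;> refine Finset.sum_congr rfl fun S hS => ?_ <;>
    have haS : a ∉ S := fun h => ha (Finset.mem_powerset.1 hS h)
  · rw [Finset.insert_sdiff_of_notMem _ haS,
      Finset.card_insert_of_notMem fun h => ha (Finset.mem_sdiff.1 h).1]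
    push_cast
    ring_nf
  · rw [Finset.insert_sdiff_insert, Finset.sdiff_insert_of_notMem ha,
      Finset.card_insert_of_notMem haS]
    push_cast
    ring_nf

theorem stateSum_add (h : ∀ S ⊆ X, 1 ≤ c S) (m : ℕ) :
    stateSum X (fun S => c S + m) = loopValue ^ m * stateSum X c := by
  rw [stateSum, stateSum, Finset.mul_sum]
  refine Finset.sum_congr rfl fun S hS => ?_
  rw [Nat.sub_add_comm (h S (Finset.mem_powerset.1 hS)), pow_add]
  ring

/-- Invariance of the bracket under the second Reidemeister move: three of the four smoothings of
the crossings `a`, `b` cancel, because `A⁻² + d + A² = 0`. -/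
theorem stateSum_insert_insert {a b : ι} (hab : a ≠ b) (ha : a ∉ X) (hb : b ∉ X)
    (h : ∀ S ⊆ X, 1 ≤ c S ∧ c (insert b S) = c S + 1 ∧ c (insert a (insert b S)) = c S) :
    stateSum (insert a (insert b X)) c = stateSum X fun S => c (insert a S) := by
  have h_cancel : T (-1) * T (-1) + loopValue + T 1 * T 1 = 0 := by
    simp only [loopValue, ← T_add, Int.reduceNeg, Int.reduceAdd]
    ring
  have h_unit : (T (-1) * T 1 : ℤ[T;T⁻¹]) = 1 := by
    rw [← T_add]
    exact T_zero
  rw [stateSum_insert (by simp [hab, ha]), stateSum_insert hb, stateSum_insert hb,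
    stateSum_congr (c := fun S => c (insert a (insert b S))) fun S hS => (h S hS).2.2,
    stateSum_congr fun S hS => (h S hS).2.1, stateSum_add fun S hS => (h S hS).1]
  linear_combination stateSum X c * h_cancel +
    (loopValue * stateSum X c + stateSum X fun S => c (insert a S)) * h_unit

theorem stateSum_union {Y : Finset ι} (hXY : Disjoint X Y) {r x y : ℤ[T;T⁻¹]}
    (h : ∀ J ⊆ Y, stateSum X (fun S => c (S ∪ J)) = r * x ^ J.card * y ^ (Y \ J).card) :
    stateSum (X ∪ Y) c = r * (T 1 * x + T (-1) * y) ^ Y.card := by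
  induction Y using Finset.induction_on generalizing c r with
  | empty => simpa using h ∅
  | insert a Y ha ih =>
    rw [Finset.disjoint_insert_right] at hXY
    have h_beta : stateSum (X ∪ Y) c = r * y * (T 1 * x + T (-1) * y) ^ Y.card := by
      refine ih hXY.2 fun J hJ => ?_
      rw [h J (hJ.trans (Finset.subset_insert a Y)),
        Finset.insert_sdiff_of_notMem _ fun haJ => ha (hJ haJ),
        Finset.card_insert_of_notMem fun haJ => ha (Finset.mem_sdiff.1 haJ).1]
      ring
    have h_alpha : stateSum (X ∪ Y) (fun S => c (insert a S)) =
        r * x * (T 1 * x + T (-1) * y) ^ Y.card := by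
      refine ih hXY.2 fun J hJ => ?_
      have := h (insert a J) (Finset.insert_subset_insert a hJ)
      rw [Finset.card_insert_of_notMem fun haJ => ha (hJ haJ), Finset.insert_sdiff_insert,
        Finset.sdiff_insert_of_notMem ha] at this
      simp only [← Finset.union_insert, this]
      ring
    rw [Finset.union_insert, stateSum_insert (by simp [hXY.1, ha]), h_beta, h_alpha,
      Finset.card_insert_of_notMem ha]
    ring

end StateSum

section ComponentCount

/-- The component labels of the vertices `0, …, N - 1` of the graph with the given edges. The edges
are contracted one after the other in a list of labels, so that the kernel can evaluate it. -/
def componentLabels (N : ℕ) : List (ℕ × ℕ) → List ℕ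
  | [] => List.range N
  | (a, b) :: ps =>
    let l := componentLabels N ps
    let i := l.getD a 0
    let j := l.getD b 0
    l.map fun x => if x = j then i else x

/-- The label of the component of the vertex `x`; the junk value `0` if `N ≤ x`. -/
def componentLabel (N : ℕ) (ps : List (ℕ × ℕ)) (x : ℕ) : ℕ := (componentLabels N ps).getD x 0

/-- The number of components of the graph on `0, …, N - 1` with the edges `ps`. -/
def componentCount (N : ℕ) (ps : List (ℕ × ℕ)) : ℕ := (componentLabels N ps).toFinset.card

variable {N : ℕ} {ps : List (ℕ × ℕ)}

theorem length_componentLabels : (componentLabels N ps).length = N := by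
  induction ps with
  | nil => exact List.length_range
  | cons e ps ih => rw [componentLabels, List.length_map, ih]

theorem componentCount_eq_card_image :
    componentCount N ps = ((Finset.range N).image (componentLabel N ps)).card := by
  refine congrArg Finset.card (Finset.ext fun i => ?_)
  simp only [componentLabel, List.mem_toFinset, List.mem_iff_getElem, Finset.mem_image,
    Finset.mem_range, length_componentLabels]
  refine exists_congr fun x => ⟨fun ⟨hx, h⟩ => ⟨hx, ?_⟩, fun ⟨hx, h⟩ => ⟨hx, ?_⟩⟩
  · rwa [List.getD_eq_getElem _ _ (length_componentLabels.symm ▸ hx)]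
  · rwa [List.getD_eq_getElem _ _ (length_componentLabels.symm ▸ hx)] at h

theorem componentLabel_nil {x : ℕ} (hx : x < N) : componentLabel N [] x = x := by
  simp [componentLabel, componentLabels, hx]

theorem componentLabel_cons {e : ℕ × ℕ} {x : ℕ} (hx : x < N) :
    componentLabel N (e :: ps) x =
      if componentLabel N ps x = componentLabel N ps e.2 then componentLabel N ps e.1
      else componentLabel N ps x := by
  simp [componentLabel, componentLabels, length_componentLabels, hx]

theorem componentLabel_fst_eq_snd (h : ∀ e ∈ ps, e.1 < N ∧ e.2 < N) {e : ℕ × ℕ} (he : e ∈ ps) :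
    componentLabel N ps e.1 = componentLabel N ps e.2 := by
  induction ps with
  | nil => simp at he
  | cons d ps ih =>
    rw [componentLabel_cons (h e he).1, componentLabel_cons (h e he).2]
    rcases List.mem_cons.1 he with rfl | he
    · simp
    · rw [ih (fun e he => h e (List.mem_cons_of_mem _ he)) he]

theorem apply_componentLabel {γ : Type*} {f : ℕ → γ}
    (h : ∀ e ∈ ps, e.1 < N ∧ e.2 < N ∧ f e.1 = f e.2) {x : ℕ} (hx : x < N) :
    f (componentLabel N ps x) = f x := by
  induction ps generalizing x with
  | nil => rw [componentLabel_nil hx]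
  | cons e ps ih =>
    have ih {y : ℕ} (hy : y < N) := ih (fun e he => h e (List.mem_cons_of_mem _ he)) hy
    obtain ⟨h1, h2, he⟩ := h e (by simp)
    rw [componentLabel_cons hx]
    split_ifs with hxe
    · rw [ih h1, he, ← ih h2, ← hxe, ih hx]
    · exact ih hx

end ComponentCount

/-- The edges `x`, `y` enter a crossing and `x'`, `y'` leave it on the same strand; their labels
are compatible with the oriented smoothing if `o` and with the other smoothing otherwise. -/
def Smooth {γ : Type*} (o : Prop) (x x' y y' : γ) : Prop :=
  (o → x = y' ∧ y = x') ∧ (¬o → x = y ∧ x' = y')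

theorem Smooth.comm {γ : Type*} {o : Prop} {x x' y y' : γ} :
    Smooth o x x' y y' ↔ Smooth o y y' x x' := by
  unfold Smooth
  grind

theorem smooth_not {γ : Type*} {o : Prop} {x x' y y' : γ} :
    Smooth (¬o) x x' y y' ↔ Smooth o x x' y' y := by
  unfold Smooth
  grind

/-- `p` and `q` are the indices of the two passages of the classical crossing `c`. -/
def IsChord (w : List Passage) (c p q : ℕ) : Prop :=
  (w[p]? = some (Passage.over c) ∧ w[q]? = some (Passage.under c)) ∨
    (w[p]? = some (Passage.under c) ∧ w[q]? = some (Passage.over c))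

theorem getElem?_append_add {α : Type*} {l l' : List α} {k : ℕ} (h : l.length = k) (i : ℕ) :
    (l ++ l')[k + i]? = l'[i]? := by
  rw [List.getElem?_append_right (by omega), h, Nat.add_sub_cancel_left]

theorem getElem?_eq_some_unique {α : Type*} [DecidableEq α] {l : List α} {a : α}
    (h : l.count a ≤ 1) {i j : ℕ} (hi : l[i]? = some a) (hj : l[j]? = some a) : i = j := by
  wlog hij : i ≤ j generalizing i j
  · exact (this hj hi (le_of_not_ge hij)).symm
  by_contra hne
  obtain ⟨hi', rfl⟩ := List.getElem?_eq_some_iff.1 hi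
  obtain ⟨hj', hj⟩ := List.getElem?_eq_some_iff.1 hj
  have h_dup : List.Duplicate l[i] l := List.duplicate_iff_exists_distinct_get.2
    ⟨⟨i, hi'⟩, ⟨j, hj'⟩, Nat.lt_of_le_of_ne hij hne, rfl, hj.symm⟩
  have := List.duplicate_iff_two_le_count.1 h_dup
  omega

namespace VirtualKnotDiagram

section StateColoring

variable {K : VirtualKnotDiagram} {S : Finset ℕ} {γ : Type*} {f : ℕ → γ}

/-- The labels `f` of the edges, which are numbered from `0` along the knot, are constant on the
closed curves of the state `S`. -/
def IsStateColoring (K : VirtualKnotDiagram) (S : Finset ℕ) (f : ℕ → γ) : Prop :=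
  ∀ x y : K.Edge, K.Joined S x y → f x = f y

/-- The labels `f` agree on the edges that are joined at the crossing `c` in the state `S`. -/
def CompatibleAt (K : VirtualKnotDiagram) (S : Finset ℕ) (f : ℕ → γ) (c : ℕ) : Prop :=
  ∀ i j, K.word[i]? = some (Passage.over c) → K.word[j]? = some (Passage.under c) →
    Smooth (c ∈ S ↔ K.sign c = 1) (f i) (f (i + 1)) (f j) (f (j + 1))

theorem isStateColoring_iff :
    K.IsStateColoring S f ↔ f K.word.length = f 0 ∧
      (∀ i v, K.word[i]? = some (Passage.virt v) → f i = f (i + 1)) ∧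
        ∀ c, K.CompatibleAt S f c := by
  constructor
  · refine fun hf => ⟨by simpa using hf _ _ .base, fun i v hi => ?_, fun c i j hi hj => ?_⟩
    · obtain ⟨h, hi⟩ := List.getElem?_eq_some_iff.1 hi
      exact hf _ _ (.virt ⟨i, h⟩ v hi)
    · obtain ⟨h, hi⟩ := List.getElem?_eq_some_iff.1 hi
      obtain ⟨h', hj⟩ := List.getElem?_eq_some_iff.1 hj
      exact ⟨fun o => ⟨hf _ _ (.oriented_over c ⟨i, h⟩ ⟨j, h'⟩ hi hj o),
          hf _ _ (.oriented_under c ⟨i, h⟩ ⟨j, h'⟩ hi hj o)⟩,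
        fun o => ⟨hf _ _ (.unoriented_in c ⟨i, h⟩ ⟨j, h'⟩ hi hj o),
          hf _ _ (.unoriented_out c ⟨i, h⟩ ⟨j, h'⟩ hi hj o)⟩⟩
  · rintro ⟨h_base, h_virt, h_compat⟩ x y hxy
    have h_get {i : K.Pos} {p : Passage} (hi : K.word.get i = p) : K.word[i.val]? = some p := by
      simp [← hi]
    cases hxy with
    | base => simpa using h_base
    | virt i v hi => exact h_virt i v (h_get hi)
    | oriented_over c i j hi hj h => exact ((h_compat c i j (h_get hi) (h_get hj)).1 h).1
    | oriented_under c i j hi hj h => exact ((h_compat c i j (h_get hi) (h_get hj)).1 h).2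
    | unoriented_in c i j hi hj h => exact ((h_compat c i j (h_get hi) (h_get hj)).2 h).1
    | unoriented_out c i j hi hj h => exact ((h_compat c i j (h_get hi) (h_get hj)).2 h).2

theorem compatibleAt_iff {c p q : ℕ} (h : IsChord K.word c p q) :
    K.CompatibleAt S f c ↔
      Smooth (c ∈ S ↔ K.sign c = 1) (f p) (f (p + 1)) (f q) (f (q + 1)) := by
  have h_over := K.over_count c
  have h_under := (K.under_count c).trans_le h_over
  rcases h with ⟨hp, hq⟩ | ⟨hp, hq⟩
  · refine ⟨fun h => h p q hp hq, fun h i j hi hj => ?_⟩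
    rwa [getElem?_eq_some_unique h_over hi hp, getElem?_eq_some_unique h_under hj hq]
  · rw [Smooth.comm]
    refine ⟨fun h => h q p hq hp, fun h i j hi hj => ?_⟩
    rwa [getElem?_eq_some_unique h_over hi hq, getElem?_eq_some_unique h_under hj hp]

/-- The closed curve of the state `S` through the edge with number `i`. -/
def curveThrough (K : VirtualKnotDiagram) (S : Finset ℕ) (i : ℕ) : Quot (K.Joined S) :=
  Quot.mk _ (Fin.ofNat _ i)

theorem curveThrough_val (x : K.Edge) : K.curveThrough S x = Quot.mk _ x := by
  simp [curveThrough]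

theorem isStateColoring_curveThrough : K.IsStateColoring S (K.curveThrough S) := fun x y h => by
  rw [curveThrough_val, curveThrough_val]
  exact Quot.sound h

theorem IsStateColoring.card_le_curves (hf : K.IsStateColoring S f) {s : Finset γ}
    (hs : ∀ c ∈ s, ∃ x ≤ K.word.length, f x = c) : s.card ≤ K.curves S := by
  rw [← Nat.card_eq_finsetCard]
  have hs (c : s) : ∃ x : K.Edge, f x = c :=
    let ⟨x, hx, hc⟩ := hs c c.2
    ⟨⟨x, Nat.lt_succ_of_le hx⟩, hc⟩
  choose g hg using hs
  refine Nat.card_le_card_of_injective (fun c => Quot.mk (K.Joined S) (g c)) fun c c' h => ?_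
  have h_eq : f (g c) = f (g c') := congrArg (Quot.lift (fun x : K.Edge => f x) hf) h
  exact Subtype.ext (by rw [← hg c, ← hg c', h_eq])

theorem curves_le_card {g : γ → Quot (K.Joined S)} {s : Finset γ}
    (hs : ∀ x ≤ K.word.length, ∃ c ∈ s, g c = K.curveThrough S x) : K.curves S ≤ s.card := by
  rw [← Nat.card_eq_finsetCard]
  refine Nat.card_le_card_of_surjective (fun c : s => g c) ?_
  rintro ⟨x⟩
  obtain ⟨c, hc, h⟩ := hs x (Nat.le_of_lt_succ x.2)
  exact ⟨⟨c, hc⟩, h.trans (curveThrough_val x)⟩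

end StateColoring

end VirtualKnotDiagram

section GaussWord

variable (b : Bool) (n : ℕ)

theorem length_twistForth : (twistForth b n).length = n := by
  simp [twistForth]

theorem length_twistBack : (twistBack b n).length = n := by
  simp [twistBack]

theorem length_endLoop : (endLoop n).length = 4 := by
  unfold endLoop
  split_ifs <;> rfl

theorem length_kmWord : (kmWord b n).length = 2 * n + 16 := by
  simp only [kmWord, List.length_append, length_twistForth, length_twistBack, length_endLoop,
    List.length_cons, List.length_nil]
  omega

theorem kmWord_getElem?_add_three (i : ℕ) : (kmWord b n)[i + 3]? =
    (twistForth b n ++ (endLoop n ++ (twistBack b n ++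
      [Passage.virt 0, Passage.over 2, Passage.under 1, Passage.under 4, Passage.virt 1,
        Passage.over 5, Passage.over 4, Passage.virt 1, Passage.under 5])))[i]? := by
  simp only [kmWord, List.append_assoc, List.cons_append, List.nil_append,
    List.getElem?_cons_succ]

theorem kmWord_getElem?_start {i : ℕ} (hi : i < 3) :
    (kmWord b n)[i]? = [Passage.under 0, Passage.over 3, Passage.virt 0][i]? := by
  simp only [kmWord, List.append_assoc]
  rw [List.getElem?_append_left hi]

variable {n} in
theorem kmWord_getElem?_forth {k : ℕ} (hk : k < n) : (kmWord b n)[k + 3]? =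
    some (if Even k ↔ b = true then Passage.over (6 + k) else Passage.under (6 + k)) := by
  rw [kmWord_getElem?_add_three,
    List.getElem?_append_left (by rwa [length_twistForth])]
  simp [twistForth, hk]

theorem kmWord_getElem?_loop {m : ℕ} (hm : m < 4) :
    (kmWord b n)[n + 3 + m]? = (endLoop n)[m]? := by
  rw [show n + 3 + m = n + m + 3 by omega, kmWord_getElem?_add_three,
    getElem?_append_add (length_twistForth b n),
    List.getElem?_append_left (by rwa [length_endLoop])]

variable {n} in
theorem kmWord_getElem?_back {k : ℕ} (hk : k < n) : (kmWord b n)[2 * n + 6 - k]? =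
    some (if Even k ↔ b = true then Passage.under (6 + k) else Passage.over (6 + k)) := by
  rw [show 2 * n + 6 - k = n + (4 + (n - 1 - k)) + 3 by omega,
    kmWord_getElem?_add_three, getElem?_append_add (length_twistForth b n),
    getElem?_append_add (length_endLoop n),
    List.getElem?_append_left (by rw [length_twistBack]; omega), twistBack,
    List.getElem?_reverse (by simp; omega)]
  simp [show n - 1 - (n - 1 - k) = k by omega, hk]

theorem kmWord_getElem?_finish (m : ℕ) : (kmWord b n)[2 * n + 7 + m]? =
    [Passage.virt 0, Passage.over 2, Passage.under 1, Passage.under 4, Passage.virt 1,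
      Passage.over 5, Passage.over 4, Passage.virt 1, Passage.under 5][m]? := by
  rw [show 2 * n + 7 + m = n + (4 + (n + m)) + 3 by omega,
    kmWord_getElem?_add_three, getElem?_append_add (length_twistForth b n),
    getElem?_append_add (length_endLoop n), getElem?_append_add (length_twistBack b n)]

theorem kmWord_index_cases (i : ℕ) :
    i < 3 ∨ (∃ k < n, i = k + 3) ∨ (∃ m < 4, i = n + 3 + m) ∨ (∃ k < n, i = 2 * n + 6 - k) ∨
      ∃ m, i = 2 * n + 7 + m := by
  by_cases h1 : i < 3
  · exact .inl h1
  by_cases h2 : i < n + 3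
  · exact .inr (.inl ⟨i - 3, by omega, by omega⟩)
  by_cases h3 : i < n + 7
  · exact .inr (.inr (.inl ⟨i - (n + 3), by omega, by omega⟩))
  by_cases h4 : i < 2 * n + 7
  · exact .inr (.inr (.inr (.inl ⟨2 * n + 6 - i, by omega, by omega⟩)))
  · exact .inr (.inr (.inr (.inr ⟨i - (2 * n + 7), by omega⟩)))

theorem exists_kmWord_getElem?_eq_virt_iff {i : ℕ} :
    (∃ v, (kmWord b n)[i]? = some (Passage.virt v)) ↔
      i = 2 ∨ i = 2 * n + 7 ∨ i = 2 * n + 11 ∨ i = 2 * n + 14 := by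
  constructor
  · rintro ⟨v, h⟩
    rcases kmWord_index_cases n i with hi | ⟨k, hk, rfl⟩ | ⟨m, hm, rfl⟩ | ⟨k, hk, rfl⟩ | ⟨m, rfl⟩
    · rw [kmWord_getElem?_start b n hi] at h
      interval_cases i <;> simp_all
    · rw [kmWord_getElem?_forth b hk] at h
      split_ifs at h <;> simp_all
    · rw [kmWord_getElem?_loop b n hm, endLoop] at h
      split_ifs at h <;> interval_cases m <;> simp_all
    · rw [kmWord_getElem?_back b hk] at h
      split_ifs at h <;> simp_all
    · rw [kmWord_getElem?_finish] at h
      have hm := (List.getElem?_eq_some_iff.1 h).1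
      simp only [List.length_cons, List.length_nil] at hm
      interval_cases m <;> simp_all
  · rintro (rfl | rfl | rfl | rfl)
    · exact ⟨0, kmWord_getElem?_start b n (by omega)⟩
    · exact ⟨0, kmWord_getElem?_finish b n 0⟩
    · exact ⟨1, kmWord_getElem?_finish b n 4⟩
    · exact ⟨1, kmWord_getElem?_finish b n 7⟩

variable {n} in
theorem isChord_twist {k : ℕ} (hk : k < n) :
    IsChord (kmWord b n) (6 + k) (k + 3) (2 * n + 6 - k) := by
  rw [IsChord, kmWord_getElem?_forth b hk, kmWord_getElem?_back b hk]
  split_ifs <;> simp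

/-- The index of the `m`-th passage of the end loop, whose direction depends on the parity of the
number of half twists. -/
def loopIndex (m : ℕ) : ℕ := if Even n then n + 3 + m else n + 6 - m

theorem kmWord_getElem?_loopIndex {m : ℕ} (hm : m < 4) : (kmWord b n)[loopIndex n m]? =
    [Passage.over 0, Passage.over 1, Passage.under 2, Passage.under 3][m]? := by
  by_cases hn : Even n
  · rw [loopIndex, if_pos hn, kmWord_getElem?_loop b n hm, endLoop, if_pos hn]
  · rw [loopIndex, if_neg hn, show n + 6 - m = n + 3 + (3 - m) by omega,
      kmWord_getElem?_loop b n (by omega), endLoop, if_neg hn]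
    interval_cases m <;> rfl

theorem isChord_zero : IsChord (kmWord b n) 0 0 (loopIndex n 0) :=
  .inr ⟨kmWord_getElem?_start b n (by omega), kmWord_getElem?_loopIndex b n (by omega)⟩

theorem isChord_one : IsChord (kmWord b n) 1 (2 * n + 9) (loopIndex n 1) :=
  .inr ⟨kmWord_getElem?_finish b n 2, kmWord_getElem?_loopIndex b n (by omega)⟩

theorem isChord_two : IsChord (kmWord b n) 2 (2 * n + 8) (loopIndex n 2) :=
  .inl ⟨kmWord_getElem?_finish b n 1, kmWord_getElem?_loopIndex b n (by omega)⟩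

theorem isChord_three : IsChord (kmWord b n) 3 1 (loopIndex n 3) :=
  .inl ⟨kmWord_getElem?_start b n (by omega), kmWord_getElem?_loopIndex b n (by omega)⟩

theorem isChord_four : IsChord (kmWord b n) 4 (2 * n + 10) (2 * n + 13) :=
  .inr ⟨kmWord_getElem?_finish b n 3, kmWord_getElem?_finish b n 6⟩

theorem isChord_five : IsChord (kmWord b n) 5 (2 * n + 12) (2 * n + 15) :=
  .inl ⟨kmWord_getElem?_finish b n 5, kmWord_getElem?_finish b n 8⟩

end GaussWord

/-- The diagram `K_m(t)` with `|t| = n`, where `b` says whether `0 < t`. -/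
def kmDiagram (b : Bool) (n : ℕ) : VirtualKnotDiagram where
  word := kmWord b n
  sign := kmSign b n
  over_count c := by rw [kmWord_count_over]; split_ifs <;> omega
  under_count c := by rw [kmWord_count_over, kmWord_count_under]
  virt_count v := by rw [kmWord_count_virt]; split_ifs <;> simp

/-- The labels `α`, `β` of two antiparallel strands are compatible with smoothings of the `n`
crossings between them, of which the `k`-th is smoothed with its orientation if `p k`. -/
def IsLadder {γ : Type*} (n : ℕ) (p : ℕ → Prop) (α β : ℕ → γ) : Prop :=
  ∀ k < n, Smooth (p k) (α k) (α (k + 1)) (β (k + 1)) (β k)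

/-- The pairs of edges joined by the smoothing of a crossing, which respects the orientation
if `o`; the strands of the crossing run from `x` to `x'` and from `y` to `y'`. -/
def smoothPairs (o : Bool) (x x' y y' : ℕ) : List (ℕ × ℕ) :=
  if o then [(x, y'), (y, x')] else [(x, y), (x', y')]

/-- The pairs of edges joined in a state at the base point, the virtual crossings and the crossings
`0, …, 5`. The `19` edges that meet one of them are numbered independently of the number of half
twists: `4, …, 8` are met along the end loop, always in the direction from crossing `0` to crossing
`3`, and the strands of the band join `3`, `9` to `4`, `8`. -/
def corePairs (S : Finset ℕ) : List (ℕ × ℕ) :=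
  [(18, 0), (2, 3), (9, 10), (13, 14), (16, 17)] ++
    smoothPairs (decide (0 ∈ S)) 0 1 4 5 ++ smoothPairs (decide (1 ∉ S)) 11 12 5 6 ++
    smoothPairs (decide (2 ∉ S)) 10 11 6 7 ++ smoothPairs (decide (3 ∈ S)) 1 2 7 8 ++
    smoothPairs (decide (4 ∉ S)) 12 13 15 16 ++ smoothPairs (decide (5 ∈ S)) 14 15 17 18

/-- The number along `K_m(t)` of the edge with number `x` in `corePairs`. -/
def coreEdge (n x : ℕ) : ℕ :=
  if x ≤ 3 then x else if x ≤ 8 then (if Even n then n + x - 1 else n + 11 - x) else 2 * n + x - 2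

/-- In the state `S` of `K_m(t)` the half twist with number `k` is smoothed with its orientation. -/
def IsOrientedTwist (b : Bool) (S : Finset ℕ) (k : ℕ) : Prop :=
  6 + k ∈ S ↔ b = true

instance (b : Bool) (S : Finset ℕ) : DecidablePred (IsOrientedTwist b S) :=
  fun _ => inferInstanceAs (Decidable (_ ↔ _))

section CoreColoring

variable {γ : Type*} {f : ℕ → γ} {S : Finset ℕ} {b : Bool} {n : ℕ}

theorem forall_mem_smoothPairs_iff {o : Bool} {x x' y y' : ℕ} :
    (∀ e ∈ smoothPairs o x x' y y', f e.1 = f e.2) ↔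
      Smooth (o = true) (f x) (f x') (f y) (f y') := by
  cases o <;> simp [smoothPairs, Smooth]

theorem coreEdge_eq_loopIndex {m : ℕ} (hm : m < 4) :
    (Even n ∧ coreEdge n (m + 4) = loopIndex n m ∧ coreEdge n (m + 5) = loopIndex n m + 1) ∨
      (¬Even n ∧ coreEdge n (m + 4) = loopIndex n m + 1 ∧
        coreEdge n (m + 5) = loopIndex n m) := by
  grind [coreEdge, loopIndex]

theorem smooth_loopIndex_iff {P : Prop} {ε : ℤˣ} {x x' : γ} {m : ℕ} (hm : m < 4) :
    Smooth (P ↔ (if Even n then ε else -ε) = 1) x x' (f (loopIndex n m)) (f (loopIndex n m + 1)) ↔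
      Smooth (P ↔ ε = 1) x x' (f (coreEdge n (m + 4))) (f (coreEdge n (m + 5))) := by
  rcases coreEdge_eq_loopIndex (n := n) hm with ⟨hn, h4, h5⟩ | ⟨hn, h4, h5⟩
  · rw [if_pos hn, h4, h5]
  · have h_sign : (P ↔ -ε = 1) ↔ ¬(P ↔ ε = 1) := by
      rcases Int.units_eq_one_or ε with rfl | rfl <;> simp
    rw [if_neg hn, h4, h5, h_sign, smooth_not]

theorem kmDiagram_virt_iff :
    (∀ i v, (kmDiagram b n).word[i]? = some (Passage.virt v) → f i = f (i + 1)) ↔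
      f 2 = f 3 ∧ f (2 * n + 7) = f (2 * n + 8) ∧ f (2 * n + 11) = f (2 * n + 12) ∧
        f (2 * n + 14) = f (2 * n + 15) := by
  have h_iff (i : ℕ) := exists_kmWord_getElem?_eq_virt_iff b n (i := i)
  simp only [← exists_imp, kmDiagram, h_iff]
  constructor
  · exact fun h => ⟨h _ (by simp), h _ (by simp), h _ (by simp), h _ (by simp)⟩
  · rintro ⟨h1, h2, h3, h4⟩ i (rfl | rfl | rfl | rfl) <;> assumption

theorem kmDiagram_compatibleAt_twist_iff {k : ℕ} (hk : k < n) :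
    (kmDiagram b n).CompatibleAt S f (6 + k) ↔ Smooth (IsOrientedTwist b S k) (f (k + 3))
      (f (k + 1 + 3)) (f (2 * n + 7 - (k + 1))) (f (2 * n + 7 - k)) := by
  have h_sign : kmSign b n (6 + k) = 1 ↔ b = true := by
    rw [Nat.add_comm]
    cases b <;> simp [kmSign]
  rw [VirtualKnotDiagram.compatibleAt_iff (isChord_twist b hk), IsOrientedTwist, ← h_sign,
    Nat.add_right_comm k,
    show 2 * n + 7 - (k + 1) = 2 * n + 6 - k by omega,
    show 2 * n + 7 - k = 2 * n + 6 - k + 1 by omega]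
  rfl

theorem kmDiagram_forall_compatibleAt_iff :
    (∀ c, (kmDiagram b n).CompatibleAt S f c) ↔
      (∀ c < 6, (kmDiagram b n).CompatibleAt S f c) ∧
        IsLadder n (IsOrientedTwist b S) (fun k => f (k + 3)) fun k => f (2 * n + 7 - k) := by
  refine ⟨fun h => ⟨fun c _ => h c, fun k hk => (kmDiagram_compatibleAt_twist_iff hk).1 (h _)⟩,
    fun ⟨h_core, h_ladder⟩ c => ?_⟩
  rcases lt_or_ge c 6 with hc | hc
  · exact h_core c hc
  obtain ⟨k, rfl⟩ := Nat.exists_eq_add_of_le hc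
  rcases lt_or_ge k n with hk | hk
  · exact (kmDiagram_compatibleAt_twist_iff hk).2 (h_ladder k hk)
  · intro i j hi _
    have h_count := kmWord_count_over b n (6 + k)
    rw [if_neg (by omega), List.count_eq_zero] at h_count
    exact absurd (List.mem_of_getElem? hi) h_count

theorem kmDiagram_forall_compatibleAt_core_iff :
    (∀ c < 6, (kmDiagram b n).CompatibleAt S f c) ↔
      (∀ e ∈ smoothPairs (decide (0 ∈ S)) 0 1 4 5 ++ smoothPairs (decide (1 ∉ S)) 11 12 5 6 ++
        smoothPairs (decide (2 ∉ S)) 10 11 6 7 ++ smoothPairs (decide (3 ∈ S)) 1 2 7 8 ++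
        smoothPairs (decide (4 ∉ S)) 12 13 15 16 ++ smoothPairs (decide (5 ∈ S)) 14 15 17 18,
        f (coreEdge n e.1) = f (coreEdge n e.2)) := by
  have h_pairs {o : Bool} {x x' y y' : ℕ} :=
    forall_mem_smoothPairs_iff (f := fun x => f (coreEdge n x)) (o := o) (x := x) (x' := x')
      (y := y) (y' := y')
  have h_chord {c p q : ℕ} (h : IsChord (kmWord b n) c p q) :=
    VirtualKnotDiagram.compatibleAt_iff (K := kmDiagram b n) (S := S) (f := f) h
  have h0 := (h_chord (isChord_zero b n)).trans (smooth_loopIndex_iff (ε := 1) (by omega))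
  have h1 := (h_chord (isChord_one b n)).trans (smooth_loopIndex_iff (ε := -1) (by omega))
  have h2 := (h_chord (isChord_two b n)).trans (smooth_loopIndex_iff (ε := -1) (by omega))
  have h3 := (h_chord (isChord_three b n)).trans (smooth_loopIndex_iff (ε := 1) (by omega))
  simp only [Nat.forall_lt_succ_right, Nat.not_lt_zero, IsEmpty.forall_iff, implies_true,
    true_and, and_assoc, List.forall_mem_append, h_pairs, h0, h1, h2, h3,
    h_chord (isChord_four b n), h_chord (isChord_five b n)]
  simp [kmDiagram, kmSign, coreEdge]

theorem kmDiagram_isStateColoring_iff :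
    (kmDiagram b n).IsStateColoring S f ↔
      (∀ e ∈ corePairs S, f (coreEdge n e.1) = f (coreEdge n e.2)) ∧
        IsLadder n (IsOrientedTwist b S) (fun k => f (k + 3)) fun k => f (2 * n + 7 - k) := by
  have h_length : (kmDiagram b n).word.length = coreEdge n 18 := length_kmWord b n
  rw [VirtualKnotDiagram.isStateColoring_iff, kmDiagram_virt_iff, kmDiagram_forall_compatibleAt_iff,
    kmDiagram_forall_compatibleAt_core_iff, h_length]
  simp only [corePairs, List.forall_mem_append, List.forall_mem_cons, List.not_mem_nil,
    IsEmpty.forall_iff, implies_true, true_and, and_assoc]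
  rfl

end CoreColoring

section Ladder

variable {γ : Type*} {n : ℕ} {p : ℕ → Prop} {α β : ℕ → γ}

theorem IsLadder.eq_of_straight (h : IsLadder n p α β) (hp : ∀ k < n, ¬p k) {k : ℕ}
    (hk : k ≤ n) :
    α k = (if Even k then α 0 else β 0) ∧ β k = if Even k then β 0 else α 0 := by
  induction k with
  | zero => simp
  | succ k ih =>
    obtain ⟨h_in, h_out⟩ := (h k hk).2 (hp k hk)
    obtain ⟨hα, hβ⟩ := ih (Nat.le_of_succ_le hk)
    rw [h_out, ← h_in, hα, hβ]
    by_cases hk : Even k <;> simp [hk, Nat.even_add_one]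

theorem IsLadder.eq_of_cut (h : IsLadder n p α β) (hp : ∃ i < n, p i) {k : ℕ} (hk : k ≤ n) :
    α k = β k := by
  have h_step {i : ℕ} (hi : i < n) : α i = β i ↔ α (i + 1) = β (i + 1) := by
    by_cases hpi : p i
    · exact iff_of_true ((h i hi).1 hpi).1 ((h i hi).1 hpi).2.symm
    · rw [((h i hi).2 hpi).1, ((h i hi).2 hpi).2, eq_comm]
  have h_zero {i : ℕ} (hi : i ≤ n) : α i = β i ↔ α 0 = β 0 := by
    induction i with
    | zero => rfl
    | succ i ih => rw [← h_step hi, ih (Nat.le_of_succ_le hi)]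
  obtain ⟨i, hi, hpi⟩ := hp
  exact (h_zero hk).2 ((h_zero hi.le).1 ((h i hi).1 hpi).1)

theorem IsLadder.eq_of_count_eq [DecidablePred p] (h : IsLadder n p α β) (hp : ∃ i < n, p i)
    {k l : ℕ} (hk : k ≤ n) (hl : l ≤ n) (h_count : Nat.count p k = Nat.count p l) :
    α k = α l := by
  wlog hkl : k ≤ l generalizing k l
  · exact (this hl hk h_count.symm (le_of_not_ge hkl)).symm
  induction l, hkl using Nat.le_induction with
  | base => rfl
  | succ l hkl ih =>
    have h_mono := Nat.count_monotone p hkl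
    rw [Nat.count_succ] at h_count
    split_ifs at h_count with hpl
    · omega
    · rw [ih (Nat.le_of_succ_le hl) h_count, ((h l hl).2 hpl).1, h.eq_of_cut hp hl]

theorem exists_count_eq [DecidablePred p] {i : ℕ} (hi : i ≤ Nat.count p n) :
    ∃ k ≤ n, Nat.count p k = i := by
  induction n with
  | zero => exact ⟨0, le_rfl, by simp_all⟩
  | succ n ih =>
    rcases hi.eq_or_lt with h | h
    · exact ⟨n + 1, le_rfl, h.symm⟩
    · obtain ⟨k, hk, h_eq⟩ := ih (by rw [Nat.count_succ] at h; split_ifs at h <;> omega)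
      exact ⟨k, by omega, h_eq⟩

end Ladder

/-- The edges of the band at its ends, in the numbering of `corePairs`, joined as in the states
with (`cut`) or without an oriented smoothing of a half twist. -/
def bandPairs (cut : Bool) : List (ℕ × ℕ) :=
  if cut then [(3, 9), (4, 8)] else [(3, 4), (9, 8)]

/-- The closed curve, in the numbering of `corePairs`, that meets the edge `x` outside the
band. -/
def coreLabel (cut : Bool) (S : Finset ℕ) (x : ℕ) : ℕ :=
  componentLabel 19 (corePairs S ++ bandPairs cut) x

/-- The number of closed curves of a state of `K_m(t)` that leave the band. -/
def coreCount (cut : Bool) (S : Finset ℕ) : ℕ :=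
  componentCount 19 (corePairs S ++ bandPairs cut)

/-- Labels of the edges of `K_m(t)`: `α` and `β` along the strands of the band, and `u` elsewhere,
in the numbering of `corePairs`. -/
def bandLabels {γ : Type*} (n : ℕ) (u α β : ℕ → γ) (x : ℕ) : γ :=
  if x < 3 then u x else if x ≤ n + 3 then α (x - 3) else
    if x < n + 7 then u (if Even n then x + 1 - n else n + 11 - x) else
      if x ≤ 2 * n + 7 then β (2 * n + 7 - x) else u (x + 2 - 2 * n)

section Curves

variable {γ : Type*} {b : Bool} {n : ℕ} {S : Finset ℕ}

theorem coreEdge_forth_end : coreEdge n (if Even n then 4 else 8) = n + 3 := by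
  by_cases hn : Even n <;> simp [coreEdge, hn]

theorem coreEdge_back_end : coreEdge n (if Even n then 8 else 4) = n + 7 := by
  by_cases hn : Even n <;> simp [coreEdge, hn]

theorem coreEdge_le {x : ℕ} (hx : x < 19) : coreEdge n x ≤ 2 * n + 16 := by
  unfold coreEdge
  split_ifs <;> omega

theorem edge_cases {x : ℕ} (hx : x ≤ 2 * n + 16) :
    (∃ k ≤ n, x = k + 3) ∨ (∃ k ≤ n, x = 2 * n + 7 - k) ∨ ∃ y < 19, x = coreEdge n y := by
  by_cases h_forth : 3 ≤ x ∧ x ≤ n + 3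
  · exact .inl ⟨x - 3, by omega, by omega⟩
  by_cases h_back : n + 7 ≤ x ∧ x ≤ 2 * n + 7
  · exact .inr (.inl ⟨2 * n + 7 - x, by omega, by omega⟩)
  refine .inr (.inr ⟨if x < 3 then x else if x < n + 7 then
    if Even n then x + 1 - n else n + 11 - x else x + 2 - 2 * n, ?_⟩)
  grind [coreEdge]

theorem bandLabels_forth {u α β : ℕ → γ} {k : ℕ} (hk : k ≤ n) :
    bandLabels n u α β (k + 3) = α k := by
  simp [bandLabels, hk]

theorem bandLabels_back {u α β : ℕ → γ} {k : ℕ} (hk : k ≤ n) :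
    bandLabels n u α β (2 * n + 7 - k) = β k := by
  unfold bandLabels
  rw [if_neg (by omega), if_neg (by omega), if_neg (by omega), if_pos (by omega),
    Nat.sub_sub_self (by omega)]

theorem bandLabels_coreEdge {u α β : ℕ → γ} (hα₀ : α 0 = u 3) (hβ₀ : β 0 = u 9)
    (hα : α n = u (if Even n then 4 else 8)) (hβ : β n = u (if Even n then 8 else 4)) (x : ℕ) :
    bandLabels n u α β (coreEdge n x) = u x := by
  unfold bandLabels coreEdge
  grind

theorem kmDiagram_isStateColoring_bandLabels {u α β : ℕ → γ}
    (hα₀ : α 0 = u 3) (hβ₀ : β 0 = u 9) (hα : α n = u (if Even n then 4 else 8))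
    (hβ : β n = u (if Even n then 8 else 4)) (hu : ∀ e ∈ corePairs S, u e.1 = u e.2)
    (h : IsLadder n (IsOrientedTwist b S) α β) :
    (kmDiagram b n).IsStateColoring S (bandLabels n u α β) := by
  rw [kmDiagram_isStateColoring_iff]
  refine ⟨fun e he => ?_, fun k hk => ?_⟩
  · rw [bandLabels_coreEdge hα₀ hβ₀ hα hβ, bandLabels_coreEdge hα₀ hβ₀ hα hβ, hu e he]
  · beta_reduce
    rw [bandLabels_forth hk.le, bandLabels_forth hk, bandLabels_back hk.le, bandLabels_back hk]
    exact h k hk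

theorem forall_mem_smoothPairs_lt_iff {N : ℕ} {o : Bool} {x x' y y' : ℕ} :
    (∀ e ∈ smoothPairs o x x' y y', e.1 < N ∧ e.2 < N) ↔ x < N ∧ x' < N ∧ y < N ∧ y' < N := by
  cases o <;> simp [smoothPairs] <;> omega

theorem forall_mem_corePairs_append_lt (cut : Bool) (S : Finset ℕ) :
    ∀ e ∈ corePairs S ++ bandPairs cut, e.1 < 19 ∧ e.2 < 19 := by
  simp only [corePairs, List.forall_mem_append, forall_mem_smoothPairs_lt_iff]
  cases cut <;> decide

theorem coreLabel_fst_eq_snd {cut : Bool} {e : ℕ × ℕ} (he : e ∈ corePairs S ++ bandPairs cut) :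
    coreLabel cut S e.1 = coreLabel cut S e.2 :=
  componentLabel_fst_eq_snd (forall_mem_corePairs_append_lt cut S) he

theorem apply_coreLabel {cut : Bool} {f : ℕ → γ} (h_core : ∀ e ∈ corePairs S, f e.1 = f e.2)
    (h_band : ∀ e ∈ bandPairs cut, f e.1 = f e.2) {x : ℕ} (hx : x < 19) :
    f (coreLabel cut S x) = f x :=
  apply_componentLabel (fun e he =>
    have h_lt := forall_mem_corePairs_append_lt cut S e he
    ⟨h_lt.1, h_lt.2, (List.mem_append.1 he).elim (h_core e) (h_band e)⟩) hx

theorem coreCount_eq_card_image {cut : Bool} :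
    coreCount cut S = ((Finset.range 19).image (coreLabel cut S)).card :=
  componentCount_eq_card_image

theorem coreCount_le_curves_of_straight (hS : ∀ k < n, ¬IsOrientedTwist b S k) :
    coreCount false S ≤ (kmDiagram b n).curves S := by
  set L := coreLabel false S
  have h_core (e) (he : e ∈ corePairs S) : L e.1 = L e.2 :=
    coreLabel_fst_eq_snd (List.mem_append_left _ he)
  have h34 : L 3 = L 4 := coreLabel_fst_eq_snd (e := (3, 4)) (by simp [bandPairs])
  have h98 : L 9 = L 8 := coreLabel_fst_eq_snd (e := (9, 8)) (by simp [bandPairs])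
  set α : ℕ → ℕ := fun k => if Even k then L 3 else L 9 with hα
  set β : ℕ → ℕ := fun k => if Even k then L 9 else L 3 with hβ
  have hα₀ : α 0 = L 3 := by simp [hα]
  have hβ₀ : β 0 = L 9 := by simp [hβ]
  have hαn : α n = L (if Even n then 4 else 8) := by grind
  have hβn : β n = L (if Even n then 8 else 4) := by grind
  have h_ladder : IsLadder n (IsOrientedTwist b S) α β := fun k hk =>
    ⟨fun h => absurd h (hS k hk), fun _ => by
      by_cases hk : Even k <;> simp [hα, hβ, hk, Nat.even_add_one]⟩
  rw [coreCount_eq_card_image]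
  refine (kmDiagram_isStateColoring_bandLabels hα₀ hβ₀ hαn hβn h_core h_ladder).card_le_curves
    fun c hc => ?_
  obtain ⟨x, hx, rfl⟩ := Finset.mem_image.1 hc
  exact ⟨coreEdge n x, (coreEdge_le (Finset.mem_range.1 hx)).trans_eq (length_kmWord b n).symm,
    bandLabels_coreEdge hα₀ hβ₀ hαn hβn x⟩

theorem curves_le_coreCount_of_straight (hS : ∀ k < n, ¬IsOrientedTwist b S k) :
    (kmDiagram b n).curves S ≤ coreCount false S := by
  set g := (kmDiagram b n).curveThrough S with hg
  obtain ⟨h_core, h_ladder⟩ := kmDiagram_isStateColoring_iff.1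
    (VirtualKnotDiagram.isStateColoring_curveThrough (K := kmDiagram b n) (S := S))
  have h_strand {k : ℕ} (hk : k ≤ n) := h_ladder.eq_of_straight hS hk
  have h_band : ∀ e ∈ bandPairs false, g (coreEdge n e.1) = g (coreEdge n e.2) := by
    have h_end := h_strand le_rfl
    simp only [show 2 * n + 7 - n = n + 7 by omega, ← hg] at h_end
    rw [← coreEdge_forth_end (n := n), ← coreEdge_back_end (n := n)] at h_end
    suffices g (coreEdge n 3) = g (coreEdge n 4) ∧ g (coreEdge n 9) = g (coreEdge n 8) by
      simpa [bandPairs]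
    by_cases hn : Even n
    · simp only [hn, if_true] at h_end
      exact ⟨h_end.1.symm, h_end.2.symm⟩
    · simp only [hn, if_false] at h_end
      exact ⟨h_end.2.symm, h_end.1.symm⟩
  rw [coreCount_eq_card_image]
  refine VirtualKnotDiagram.curves_le_card (g := fun x => g (coreEdge n x)) fun x hx => ?_
  obtain ⟨y, hy, hxy⟩ : ∃ y < 19, g x = g (coreEdge n y) := by
    rcases edge_cases (hx.trans_eq (length_kmWord b n)) with ⟨k, hk, rfl⟩ | ⟨k, hk, rfl⟩ | h
    · exact ⟨if Even k then 3 else 9, by grind, (h_strand hk).1.trans (by split_ifs <;> rfl)⟩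
    · exact ⟨if Even k then 9 else 3, by grind, (h_strand hk).2.trans (by split_ifs <;> rfl)⟩
    · obtain ⟨y, hy, rfl⟩ := h
      exact ⟨y, hy, rfl⟩
  exact ⟨coreLabel false S y, Finset.mem_image_of_mem _ (Finset.mem_range.2 hy),
    (apply_coreLabel (f := fun x => g (coreEdge n x)) h_core h_band hy).trans hxy.symm⟩

theorem coreCount_add_le_curves_of_cut {j : ℕ}
    (hj : Nat.count (IsOrientedTwist b S) n = j + 1) :
    coreCount true S + j ≤ (kmDiagram b n).curves S := by
  set L := coreLabel true S
  have h_core (e) (he : e ∈ corePairs S) : L e.1 = L e.2 :=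
    coreLabel_fst_eq_snd (List.mem_append_left _ he)
  have h39 : L 3 = L 9 := coreLabel_fst_eq_snd (e := (3, 9)) (by simp [bandPairs])
  have h48 : L 4 = L 8 := coreLabel_fst_eq_snd (e := (4, 8)) (by simp [bandPairs])
  set u : ℕ → ℕ ⊕ ℕ := fun x => Sum.inl (L x)
  set α : ℕ → ℕ ⊕ ℕ := fun k => if Nat.count (IsOrientedTwist b S) k = 0 then u 3 else
    if Nat.count (IsOrientedTwist b S) k = j + 1 then u 4 else
      Sum.inr (Nat.count (IsOrientedTwist b S) k - 1) with hα
  have hα₀ : α 0 = u 3 := by simp [hα]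
  have hβ₀ : α 0 = u 9 := hα₀.trans (congrArg Sum.inl h39)
  have hαn : α n = u 4 := by simp [hα, hj]
  have hu8 : u 4 = u 8 := congrArg Sum.inl h48
  have h_ladder : IsLadder n (IsOrientedTwist b S) α α := by
    refine fun k _ => ⟨fun _ => ⟨rfl, rfl⟩, fun hk => ?_⟩
    have h_const : α k = α (k + 1) := by simp only [hα, Nat.count_succ, hk, if_false, add_zero]
    exact ⟨h_const, h_const.symm⟩
  have hα_end : α n = u (if Even n then 4 else 8) := by rw [hαn, apply_ite u, ← hu8, ite_self]
  have hβ_end : α n = u (if Even n then 8 else 4) := by rw [hαn, apply_ite u, ← hu8, ite_self]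
  rw [coreCount_eq_card_image, ← Finset.card_range j, ← Finset.card_disjSum]
  refine (kmDiagram_isStateColoring_bandLabels hα₀ hβ₀ hα_end hβ_end
    (fun e he => congrArg Sum.inl (h_core e he)) h_ladder).card_le_curves fun c hc => ?_
  rw [show (kmDiagram b n).word.length = 2 * n + 16 from length_kmWord b n]
  rcases Finset.mem_disjSum.1 hc with ⟨a, ha, rfl⟩ | ⟨i, hi, rfl⟩
  · obtain ⟨x, hx, rfl⟩ := Finset.mem_image.1 ha
    exact ⟨coreEdge n x, coreEdge_le (Finset.mem_range.1 hx),
      bandLabels_coreEdge hα₀ hβ₀ hα_end hβ_end x⟩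
  · have hi := Finset.mem_range.1 hi
    obtain ⟨k, hk, h_count⟩ := exists_count_eq (i := i + 1) (hj.symm ▸ (by omega : i + 1 ≤ j + 1))
    refine ⟨k + 3, by omega, ?_⟩
    rw [bandLabels_forth hk]
    simp only [hα, h_count]
    rw [if_neg (by omega), if_neg (by omega), Nat.add_sub_cancel]

theorem kmDiagram_strands_eq_of_cut {f : ℕ → γ} (hf : (kmDiagram b n).IsStateColoring S f)
    (h_cut : ∃ k < n, IsOrientedTwist b S k) {k : ℕ} (hk : k ≤ n) :
    f (k + 3) = f (2 * n + 7 - k) :=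
  (kmDiagram_isStateColoring_iff.1 hf).2.eq_of_cut h_cut hk

theorem kmDiagram_band_end_eq_of_cut {f : ℕ → γ} (hf : (kmDiagram b n).IsStateColoring S f)
    (h_cut : ∃ k < n, IsOrientedTwist b S k) :
    f (n + 3) = f (coreEdge n 4) ∧ f (n + 3) = f (coreEdge n 8) := by
  have h_end := kmDiagram_strands_eq_of_cut hf h_cut le_rfl
  rw [show 2 * n + 7 - n = n + 7 by omega] at h_end
  by_cases hn : Even n <;> simp [coreEdge, hn, h_end]

theorem kmDiagram_edge_cases_of_cut {f : ℕ → γ} (hf : (kmDiagram b n).IsStateColoring S f)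
    (h_cut : ∃ k < n, IsOrientedTwist b S k) {x : ℕ} (hx : x ≤ 2 * n + 16) :
    (∃ y < 19, f x = f (coreEdge n y)) ∨ ∃ k ≤ n, f x = f (k + 3) ∧
      Nat.count (IsOrientedTwist b S) k ≠ 0 ∧
        Nat.count (IsOrientedTwist b S) k ≠ Nat.count (IsOrientedTwist b S) n := by
  have h_strand {k l : ℕ} := (kmDiagram_isStateColoring_iff.1 hf).2.eq_of_count_eq h_cut
    (k := k) (l := l)
  wlog hx_forth : ∃ k ≤ n, x = k + 3 generalizing x
  · rcases edge_cases hx with h | ⟨k, hk, rfl⟩ | ⟨y, hy, rfl⟩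
    · exact absurd h hx_forth
    · rw [← kmDiagram_strands_eq_of_cut hf h_cut hk]
      exact this (by omega) ⟨k, hk, rfl⟩
    · exact .inl ⟨y, hy, rfl⟩
  obtain ⟨k, hk, rfl⟩ := hx_forth
  by_cases h_first : Nat.count (IsOrientedTwist b S) k = 0
  · exact .inl ⟨3, by omega, h_strand hk (Nat.zero_le n) (by simpa using h_first)⟩
  by_cases h_last : Nat.count (IsOrientedTwist b S) k = Nat.count (IsOrientedTwist b S) n
  · exact .inl ⟨4, by omega,
      (h_strand hk le_rfl h_last).trans (kmDiagram_band_end_eq_of_cut hf h_cut).1⟩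
  · exact .inr ⟨k, hk, rfl, h_first, h_last⟩

theorem curves_le_coreCount_add_of_cut {j : ℕ}
    (hj : Nat.count (IsOrientedTwist b S) n = j + 1) :
    (kmDiagram b n).curves S ≤ coreCount true S + j := by
  set g := (kmDiagram b n).curveThrough S with hg
  have hg_col : (kmDiagram b n).IsStateColoring S g :=
    VirtualKnotDiagram.isStateColoring_curveThrough
  obtain ⟨h_core, h_ladder⟩ := kmDiagram_isStateColoring_iff.1 hg_col
  have h_cut : ∃ k < n, IsOrientedTwist b S k := by
    by_contra! h_none
    exact absurd (Nat.count_iff_forall_not.2 h_none) (by omega)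
  have h_band : ∀ e ∈ bandPairs true, g (coreEdge n e.1) = g (coreEdge n e.2) := by
    have h_end := kmDiagram_band_end_eq_of_cut hg_col h_cut
    suffices g (coreEdge n 3) = g (coreEdge n 9) ∧ g (coreEdge n 4) = g (coreEdge n 8) by
      simpa [bandPairs]
    exact ⟨kmDiagram_strands_eq_of_cut hg_col h_cut (Nat.zero_le n), h_end.1.symm.trans h_end.2⟩
  choose! k hk h_count using fun i (hi : i ≤ Nat.count (IsOrientedTwist b S) n) =>
    exists_count_eq hi
  rw [coreCount_eq_card_image, ← Finset.card_range j, ← Finset.card_disjSum]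
  refine VirtualKnotDiagram.curves_le_card
    (g := Sum.elim (fun x => g (coreEdge n x)) fun i => g (k (i + 1) + 3)) fun x hx => ?_
  rcases kmDiagram_edge_cases_of_cut hg_col h_cut (hx.trans_eq (length_kmWord b n)) with
    ⟨y, hy, hxy⟩ | ⟨l, hl, hxl, h_first, h_last⟩
  · exact ⟨.inl (coreLabel true S y),
      Finset.inl_mem_disjSum.2 (Finset.mem_image_of_mem _ (Finset.mem_range.2 hy)),
      (apply_coreLabel (f := fun x => g (coreEdge n x)) h_core h_band hy).trans hxy.symm⟩
  · have h_le := Nat.count_monotone (IsOrientedTwist b S) hl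
    refine ⟨.inr (Nat.count (IsOrientedTwist b S) l - 1),
      Finset.inr_mem_disjSum.2 (Finset.mem_range.2 (by omega)), ?_⟩
    rw [← hg, hxl, Sum.elim_inr]
    refine h_ladder.eq_of_count_eq h_cut (hk _ (by omega)) hl ?_
    rw [h_count _ (by omega)]
    omega

theorem kmDiagram_curves : (kmDiagram b n).curves S =
    coreCount (decide (0 < Nat.count (IsOrientedTwist b S) n)) S +
      (Nat.count (IsOrientedTwist b S) n - 1) := by
  rcases hj : Nat.count (IsOrientedTwist b S) n with _ | j
  · have hS := Nat.count_iff_forall_not.1 hj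
    rw [decide_eq_false (lt_irrefl 0), Nat.zero_sub, add_zero]
    exact (curves_le_coreCount_of_straight hS).antisymm (coreCount_le_curves_of_straight hS)
  · rw [decide_eq_true j.succ_pos, Nat.add_sub_cancel]
    exact (curves_le_coreCount_add_of_cut hj).antisymm (coreCount_add_le_curves_of_cut hj)

end Curves

section Bracket

variable {b : Bool} {n : ℕ}

theorem kmDiagram_crossings (b : Bool) (n : ℕ) :
    (kmDiagram b n).crossings = Finset.range (6 + n) := by
  ext c
  have h_mem : c ∈ (kmDiagram b n).crossings ↔ Passage.over c ∈ kmWord b n := by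
    simp only [VirtualKnotDiagram.crossings, List.mem_toFinset, List.mem_filterMap]
    constructor
    · rintro ⟨p, hp, h⟩
      cases p <;> simp_all [kmDiagram]
    · exact fun h => ⟨_, h, rfl⟩
  rw [h_mem, ← List.count_pos_iff, kmWord_count_over, Finset.mem_range]
  split_ifs <;> simp_all

theorem kmDiagram_writhe (b : Bool) (n : ℕ) :
    (kmDiagram b n).writhe = if b then (n : ℤ) else -n := by
  have h_twist (k : ℕ) : (kmDiagram b n).sign (6 + k) = if b then 1 else -1 := by
    rw [Nat.add_comm]
    rfl
  rw [VirtualKnotDiagram.writhe, kmDiagram_crossings, Finset.sum_range_add]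
  simp only [h_twist, Finset.sum_const, Finset.card_range]
  by_cases hn : Even n <;> cases b <;>
    simp [Finset.sum_range_succ, kmDiagram, kmSign, hn]

theorem Km_eq_kmDiagram (t : ℤ) : Km t = kmDiagram (decide (0 < t)) t.natAbs :=
  rfl

theorem VirtualKnotDiagram.bracket_eq_stateSum (K : VirtualKnotDiagram) :
    K.bracket = stateSum K.crossings K.curves :=
  rfl

theorem coreCount_congr {cut : Bool} {S S' : Finset ℕ} (h : ∀ c < 6, c ∈ S ↔ c ∈ S') :
    coreCount cut S = coreCount cut S' := by
  simp only [coreCount, corePairs, h 0 (by omega), h 1 (by omega), h 2 (by omega),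
    h 3 (by omega), h 4 (by omega), h 5 (by omega)]

theorem coreCount_pos {cut : Bool} {S : Finset ℕ} : 1 ≤ coreCount cut S := by
  rw [coreCount_eq_card_image, Nat.one_le_iff_ne_zero]
  simp

/-- Three Reidemeister moves undo the core: they cancel the crossings of the left half, then the
overpass of the end loop, then its underpass. -/
theorem stateSum_coreCount (cut : Bool) :
    stateSum (Finset.range 6) (coreCount cut) = loopValue ^ cut.toNat :=
  calc stateSum (Finset.range 6) (coreCount cut)
    _ = stateSum (insert 5 (insert 4 {0, 1, 2, 3})) (coreCount cut) :=
      congrArg (stateSum · _) (by decide)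
    _ = stateSum {0, 1, 2, 3} fun S => coreCount cut (insert 5 S) :=
      stateSum_insert_insert (by decide) (by decide) (by decide) (by revert cut; decide +kernel)
    _ = stateSum (insert 1 (insert 0 {2, 3})) fun S => coreCount cut (insert 5 S) :=
      congrArg (stateSum · _) (by decide)
    _ = stateSum {2, 3} fun S => coreCount cut (insert 5 (insert 1 S)) :=
      stateSum_insert_insert (by decide) (by decide) (by decide) (by revert cut; decide +kernel)
    _ = stateSum (insert 3 (insert 2 ∅)) fun S => coreCount cut (insert 5 (insert 1 S)) :=
      congrArg (stateSum · _) (by decide)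
    _ = stateSum ∅ fun S => coreCount cut (insert 5 (insert 1 (insert 3 S))) :=
      stateSum_insert_insert (by decide) (by decide) (by decide) (by revert cut; decide +kernel)
    _ = loopValue ^ (coreCount cut {5, 1, 3} - 1) := stateSum_empty
    _ = loopValue ^ cut.toNat := by
      rw [show coreCount cut {5, 1, 3} - 1 = cut.toNat by revert cut; decide +kernel]

/-- The crossings of the half twists of `K_m(t)`. -/
def twistCrossings (n : ℕ) : Finset ℕ :=
  (Finset.range n).map (addLeftEmbedding 6)

theorem disjoint_range_twistCrossings : Disjoint (Finset.range 6) (twistCrossings n) :=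
  Finset.disjoint_range_addLeftEmbedding 6 _

theorem count_isOrientedTwist {S : Finset ℕ} :
    Nat.count (IsOrientedTwist b S) n = {c ∈ twistCrossings n | c ∈ S ↔ b = true}.card := by
  rw [Nat.count_eq_card_filter_range, twistCrossings, Finset.filter_map, Finset.card_map]
  rfl

theorem filter_twistCrossings_mem_union {P J : Finset ℕ} (hP : P ⊆ Finset.range 6)
    (hJ : J ⊆ twistCrossings n) : {c ∈ twistCrossings n | c ∈ P ∪ J} = J := by
  have h_disj : Disjoint (twistCrossings n) P :=
    (disjoint_range_twistCrossings.mono_left hP).symm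
  rw [Finset.filter_mem_eq_inter, Finset.inter_union_distrib_left,
    Finset.disjoint_iff_inter_eq_empty.1 h_disj, Finset.empty_union,
    Finset.inter_eq_right.2 hJ]

theorem count_isOrientedTwist_union {P J : Finset ℕ} (hP : P ⊆ Finset.range 6)
    (hJ : J ⊆ twistCrossings n) :
    Nat.count (IsOrientedTwist b (P ∪ J)) n =
      if b then J.card else (twistCrossings n \ J).card := by
  have h_filter := filter_twistCrossings_mem_union hP hJ
  rw [count_isOrientedTwist]
  cases b
  · simp only [Bool.false_eq_true, iff_false, Finset.filter_not, h_filter, if_false]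
  · simp only [iff_true, h_filter, if_true]

theorem kmDiagram_curves_union {P J : Finset ℕ} (hP : P ⊆ Finset.range 6)
    (hJ : J ⊆ twistCrossings n) {j : ℕ}
    (hj : (if b then J.card else (twistCrossings n \ J).card) = j) :
    (kmDiagram b n).curves (P ∪ J) = coreCount (decide (0 < j)) P + (j - 1) := by
  have h_core {cut : Bool} : coreCount cut (P ∪ J) = coreCount cut P := by
    refine coreCount_congr fun c hc => ?_
    have hcJ : c ∉ J := fun h =>
      Finset.disjoint_left.1 disjoint_range_twistCrossings (Finset.mem_range.2 hc) (hJ h)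
    rw [Finset.mem_union, or_iff_left hcJ]
  rw [kmDiagram_curves, count_isOrientedTwist_union hP hJ, hj, h_core]

theorem stateSum_curves_union {J : Finset ℕ} (hJ : J ⊆ twistCrossings n) :
    stateSum (Finset.range 6) (fun P => (kmDiagram b n).curves (P ∪ J)) =
      loopValue ^ if b then J.card else (twistCrossings n \ J).card := by
  generalize hj : (if b then J.card else (twistCrossings n \ J).card) = j
  rw [stateSum_congr fun P hP => kmDiagram_curves_union hP hJ hj,
    stateSum_add (fun P _ => coreCount_pos), stateSum_coreCount, ← pow_add]
  congr 1
  cases j <;> simp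

theorem T_mul_add_T_mul_loopValue :
    (T 1 * if b then loopValue else 1) + (T (-1) * if b then 1 else loopValue) =
      -T (if b then 3 else -3) := by
  cases b <;>
    simp only [loopValue, Bool.false_eq_true, if_true, if_false, mul_sub, mul_neg, mul_one,
      ← T_add, Int.reduceNeg, Int.reduceAdd] <;>
    ring

theorem kmDiagram_bracket :
    (kmDiagram b n).bracket = (-T (if b then 3 else -3)) ^ n := by
  have h_card : (twistCrossings n).card = n := by simp [twistCrossings]
  have h_sum := stateSum_union (disjoint_range_twistCrossings (n := n)) (r := 1)
    (c := (kmDiagram b n).curves) (x := if b then loopValue else 1)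
    (y := if b then 1 else loopValue) fun J hJ => by
      rw [stateSum_curves_union hJ]
      cases b <;> simp
  rw [VirtualKnotDiagram.bracket_eq_stateSum, kmDiagram_crossings, Finset.range_add]
  rw [T_mul_add_T_mul_loopValue, one_mul, h_card] at h_sum
  exact h_sum

theorem Km_bracket (t : ℤ) : (Km t).bracket = C ((Int.negOnePow t : ℤˣ) : ℤ) * T (3 * t) := by
  have h_sign : (C ((Int.negOnePow t : ℤˣ) : ℤ) : ℤ[T;T⁻¹]) = (-1) ^ t.natAbs := by
    obtain ⟨m, rfl | rfl⟩ := t.eq_nat_or_neg <;> simp [Int.negOnePow]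
  rw [Km_eq_kmDiagram, kmDiagram_bracket, neg_pow, T_pow, h_sign]
  congr 2
  grind

theorem Km_writhe (t : ℤ) : (Km t).writhe = t := by
  rw [Km_eq_kmDiagram, kmDiagram_writhe]
  grind

end Bracket

theorem conj_zpow_eq_self_iff {G : Type*} [Group G] {x y : G} {m : ℤ} :
    x ^ (-m) * y * x ^ m = x ↔ y = x := by
  rw [zpow_neg, mul_assoc, inv_mul_eq_iff_eq_mul, (Commute.zpow_self x m).eq, mul_left_inj]

namespace VirtualKnotDiagram

section Meridian

variable {K : VirtualKnotDiagram} {i j c : ℕ}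

/-- The element of the fundamental group given by the edge with number `i`. -/
def meridian (K : VirtualKnotDiagram) (i : ℕ) : K.fundamentalGroup :=
  PresentedGroup.of (Fin.ofNat _ i)

theorem meridian_val (e : K.Edge) : K.meridian e = PresentedGroup.of e := by
  simp [meridian]

theorem mk_eq_of_isRelator {x y : FreeGroup K.Edge} (h : K.IsRelator (x * y⁻¹)) :
    PresentedGroup.mk {r | K.IsRelator r} x = PresentedGroup.mk {r | K.IsRelator r} y :=
  PresentedGroup.mk_eq_mk_of_mul_inv_mem h

theorem meridian_length : K.meridian K.word.length = K.meridian 0 :=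
  (meridian_val (Fin.last _)).trans
    ((mk_eq_of_isRelator .base).trans (meridian_val (K := K) 0).symm)

theorem meridian_virt {v : ℕ} (hi : K.word[i]? = some (Passage.virt v)) :
    K.meridian (i + 1) = K.meridian i := by
  obtain ⟨h, hi⟩ := List.getElem?_eq_some_iff.1 hi
  exact (meridian_val (Fin.succ ⟨i, h⟩)).trans
    ((mk_eq_of_isRelator (.virt _ v hi)).trans (meridian_val (Fin.castSucc ⟨i, h⟩)).symm)

theorem meridian_over (hi : K.word[i]? = some (Passage.over c)) :
    K.meridian (i + 1) = K.meridian i := by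
  obtain ⟨h, hi⟩ := List.getElem?_eq_some_iff.1 hi
  exact (meridian_val (Fin.succ ⟨i, h⟩)).trans
    ((mk_eq_of_isRelator (.over _ c hi)).trans (meridian_val (Fin.castSucc ⟨i, h⟩)).symm)

theorem meridian_under (hi : K.word[i]? = some (Passage.over c))
    (hj : K.word[j]? = some (Passage.under c)) :
    K.meridian (j + 1) =
      K.meridian i ^ (-(K.sign c : ℤ)) * K.meridian j * K.meridian i ^ (K.sign c : ℤ) := by
  obtain ⟨h, hi⟩ := List.getElem?_eq_some_iff.1 hi
  obtain ⟨h', hj⟩ := List.getElem?_eq_some_iff.1 hj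
  have h_rel := mk_eq_of_isRelator (K := K) (.under c ⟨i, h⟩ ⟨j, h'⟩ hi hj)
  rw [map_mul, map_mul, map_zpow, map_zpow] at h_rel
  have h_over := meridian_val (K := K) (Fin.castSucc ⟨i, h⟩)
  have h_in := meridian_val (K := K) (Fin.castSucc ⟨j, h'⟩)
  have h_out := meridian_val (K := K) (Fin.succ ⟨j, h'⟩)
  rw [Fin.val_castSucc] at h_over h_in
  rw [Fin.val_succ] at h_out
  rw [h_over, h_in, h_out]
  exact h_rel

theorem meridian_under_eq_iff (hi : K.word[i]? = some (Passage.over c))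
    (hj : K.word[j]? = some (Passage.under c)) :
    K.meridian (j + 1) = K.meridian i ↔ K.meridian j = K.meridian i := by
  rw [meridian_under hi hj, conj_zpow_eq_self_iff]

theorem meridian_antiparallel {p q : ℕ} (h : IsChord K.word c p q)
    (hpq : K.meridian (q + 1) = K.meridian p) :
    K.meridian (p + 1) = K.meridian p ∧ K.meridian q = K.meridian p := by
  rcases h with ⟨hp, hq⟩ | ⟨hp, hq⟩
  · exact ⟨meridian_over hp, (meridian_under_eq_iff hp hq).1 hpq⟩
  · rw [meridian_over hq] at hpq
    exact ⟨((meridian_under_eq_iff hq hp).2 hpq.symm).trans hpq, hpq⟩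

/-- The linking number with the knot: the homomorphism to `ℤ` that maps every meridian to `1`. -/
def linking (K : VirtualKnotDiagram) : K.fundamentalGroup →* Multiplicative ℤ :=
  PresentedGroup.toGroup (f := fun _ => Multiplicative.ofAdd 1) (by
    rintro r (_ | _ | _ | _) <;> simp [mul_comm])

theorem linking_of (e : K.Edge) : K.linking (PresentedGroup.of e) = Multiplicative.ofAdd 1 :=
  PresentedGroup.toGroup.of _

theorem nonempty_fundamentalGroup_mulEquiv_int
    (h : ∀ i ≤ K.word.length, K.meridian i = K.meridian 0) :
    Nonempty (K.fundamentalGroup ≃* Multiplicative ℤ) := by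
  refine ⟨MonoidHom.toMulEquiv K.linking (zpowersHom _ (K.meridian 0)) ?_ ?_⟩
  · ext e
    rw [MonoidHom.comp_apply, linking_of, MonoidHom.id_apply, ← meridian_val,
      h e (Nat.le_of_lt_succ e.2)]
    simp
  · ext
    simp [meridian, linking_of]

end Meridian

end VirtualKnotDiagram

section KmMeridian

open VirtualKnotDiagram

variable (b : Bool) (n : ℕ)

local notation "μ" => VirtualKnotDiagram.meridian (kmDiagram b n)

theorem kmDiagram_meridian_left_half {m : ℕ} (hm : 10 ≤ m) (hm' : m ≤ 16) :
    μ (2 * n + m) = μ 0 := by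
  have h_get (k : ℕ) := kmWord_getElem?_finish b n k
  have h11 : μ (2 * n + 12) = μ (2 * n + 11) := meridian_virt (h_get 4)
  have h12 : μ (2 * n + 13) = μ (2 * n + 12) := meridian_over (h_get 5)
  have h13 : μ (2 * n + 14) = μ (2 * n + 13) := meridian_over (h_get 6)
  have h14 : μ (2 * n + 15) = μ (2 * n + 14) := meridian_virt (h_get 7)
  have h10 : μ (2 * n + 10) = μ (2 * n + 13) :=
    (meridian_under_eq_iff (K := kmDiagram b n) (h_get 6) (h_get 3)).1 (h12.trans h11).symm
  have h15 : μ (2 * n + 16) = μ (2 * n + 12) :=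
    (meridian_under_eq_iff (K := kmDiagram b n) (h_get 5) (h_get 8)).2
      (h14.trans (h13.trans h12))
  have h_base : μ (2 * n + 16) = μ 0 := by
    rw [← length_kmWord b n]
    exact meridian_length
  interval_cases m <;> simp only [h10, h14, h13, h12, ← h11, ← h15, h_base]

theorem kmDiagram_meridian_start : μ 1 = μ 3 ∧ μ 2 = μ 3 := by
  have h1 : μ 2 = μ 1 := meridian_over (kmWord_getElem?_start b n (by omega))
  have h2 : μ 3 = μ 2 := meridian_virt (kmWord_getElem?_start b n (by omega))
  exact ⟨(h2.trans h1).symm, h2.symm⟩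

theorem kmDiagram_meridian_middle :
    μ (2 * n + 8) = μ (2 * n + 7) ∧ μ (2 * n + 9) = μ (2 * n + 7) := by
  have h7 : μ (2 * n + 8) = μ (2 * n + 7) := meridian_virt (kmWord_getElem?_finish b n 0)
  have h8 : μ (2 * n + 9) = μ (2 * n + 8) := meridian_over (kmWord_getElem?_finish b n 1)
  exact ⟨h7, h8.trans h7⟩

theorem kmDiagram_meridian_loop_over {m : ℕ} (hm : m < 2) :
    μ (coreEdge n (m + 5)) = μ (coreEdge n (m + 4)) ∧
      μ (loopIndex n m) = μ (coreEdge n (m + 4)) := by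
  have h_over : μ (loopIndex n m + 1) = μ (loopIndex n m) := by
    have h_get := kmWord_getElem?_loopIndex b n (m := m) (by omega)
    interval_cases m <;> exact meridian_over h_get
  rcases coreEdge_eq_loopIndex (n := n) (m := m) (by omega) with ⟨-, h4, h5⟩ | ⟨-, h4, h5⟩ <;>
    simp only [h4, h5, h_over, and_self]

/-- The arc over the crossings `0` and `1` conjugates in opposite directions at its two ends. -/
theorem kmDiagram_meridian_band_start : μ (2 * n + 7) = μ 3 := by
  obtain ⟨h5, h0⟩ := kmDiagram_meridian_loop_over b n (m := 0) (by omega)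
  have h1 := (kmDiagram_meridian_loop_over b n (m := 1) (by omega)).2.trans h5
  have h_zero : μ 1 = _ := meridian_under (K := kmDiagram b n)
    (kmWord_getElem?_loopIndex b n (m := 0) (by omega))
    (kmWord_getElem?_start b n (i := 0) (by omega))
  have h_one : μ (2 * n + 10) = _ := meridian_under (K := kmDiagram b n)
    (kmWord_getElem?_loopIndex b n (m := 1) (by omega)) (kmWord_getElem?_finish b n 2)
  have h_sign : ((kmDiagram b n).sign 1 : ℤ) = -((kmDiagram b n).sign 0 : ℤ) := by
    by_cases hn : Even n <;> simp [kmDiagram, kmSign, hn]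
  rw [kmDiagram_meridian_left_half b n (by omega) (by omega), h_sign, h1,
    (kmDiagram_meridian_middle b n).2] at h_one
  rw [(kmDiagram_meridian_start b n).1, h_one, h0] at h_zero
  rw [h_zero]
  group

theorem kmDiagram_meridian_band {k : ℕ} (hk : k ≤ n) :
    μ (k + 3) = μ 3 ∧ μ (2 * n + 7 - k) = μ 3 := by
  induction k with
  | zero => exact ⟨congrArg _ (zero_add 3), kmDiagram_meridian_band_start b n⟩
  | succ k ih =>
    obtain ⟨h_forth, h_back⟩ := ih (by omega)
    rw [show 2 * n + 7 - k = 2 * n + 6 - k + 1 by omega] at h_back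
    have h := meridian_antiparallel (K := kmDiagram b n) (isChord_twist b hk)
      (h_back.trans h_forth.symm)
    rw [h_forth] at h
    rw [Nat.add_right_comm, show 2 * n + 7 - (k + 1) = 2 * n + 6 - k by omega]
    exact h

theorem kmDiagram_meridian_base : μ 3 = μ 0 ∧ μ (coreEdge n 4) = μ 0 := by
  have h4 : μ (coreEdge n 4) = μ 3 := by
    have h_end := kmDiagram_meridian_band b n le_rfl
    rw [show 2 * n + 7 - n = n + 7 by omega] at h_end
    by_cases hn : Even n <;> simp [coreEdge, hn, h_end]
  have h0 := (kmDiagram_meridian_loop_over b n (m := 0) (by omega)).2.trans h4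
  have h_zero : μ 1 = μ (loopIndex n 0) ↔ μ 0 = μ (loopIndex n 0) :=
    meridian_under_eq_iff (K := kmDiagram b n)
      (kmWord_getElem?_loopIndex b n (m := 0) (by omega))
      (kmWord_getElem?_start b n (i := 0) (by omega))
  rw [h0] at h_zero
  have h3 := (h_zero.1 (kmDiagram_meridian_start b n).1).symm
  exact ⟨h3, h4.trans h3⟩

theorem kmDiagram_meridian_loop {m : ℕ} (hm : m ≤ 4) : μ (coreEdge n (m + 4)) = μ 0 := by
  obtain ⟨h3, h4⟩ := kmDiagram_meridian_base b n
  have h_under {c i j : ℕ} (hi : (kmWord b n)[i]? = some (Passage.over c))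
      (hj : (kmWord b n)[j]? = some (Passage.under c)) (h : μ i = μ 0) :
      μ (j + 1) = μ 0 ↔ μ j = μ 0 :=
    h ▸ meridian_under_eq_iff (K := kmDiagram b n) hi hj
  induction m with
  | zero => exact h4
  | succ m ih =>
    have h_get := kmWord_getElem?_loopIndex b n (m := m) (by omega)
    have h_pass : μ (loopIndex n m + 1) = μ 0 ↔ μ (loopIndex n m) = μ 0 := by
      have : m < 4 := by omega
      interval_cases m
      · rw [meridian_over h_get]
      · rw [meridian_over h_get]
      · exact h_under (kmWord_getElem?_finish b n 1) h_get
          ((kmDiagram_meridian_middle b n).1.trans ((kmDiagram_meridian_band_start b n).trans h3))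
      · exact h_under (kmWord_getElem?_start b n (i := 1) (by omega)) h_get
          ((kmDiagram_meridian_start b n).1.trans h3)
    have ih := ih (by omega)
    rw [show m + 1 + 4 = m + 5 by omega]
    rcases coreEdge_eq_loopIndex (n := n) (m := m) (by omega) with ⟨-, h4, h5⟩ | ⟨-, h4, h5⟩ <;>
      rw [h4] at ih <;> rw [h5]
    · exact h_pass.2 ih
    · exact h_pass.1 ih

theorem kmDiagram_meridian_eq {x : ℕ} (hx : x ≤ 2 * n + 16) : μ x = μ 0 := by
  have h3 := (kmDiagram_meridian_base b n).1
  rcases edge_cases hx with ⟨k, hk, rfl⟩ | ⟨k, hk, rfl⟩ | ⟨y, hy, rfl⟩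
  · exact (kmDiagram_meridian_band b n hk).1.trans h3
  · exact (kmDiagram_meridian_band b n hk).2.trans h3
  have h_start := kmDiagram_meridian_start b n
  have h_middle := kmDiagram_meridian_middle b n
  rw [h3] at h_start
  rw [kmDiagram_meridian_band_start, h3] at h_middle
  rcases lt_or_ge y 12 with h | h
  · by_cases h_loop : 4 ≤ y ∧ y ≤ 8
    · obtain ⟨m, rfl⟩ := Nat.exists_eq_add_of_le' h_loop.1
      exact kmDiagram_meridian_loop b n (by omega)
    · have h_band := (kmDiagram_meridian_band_start b n).trans h3
      interval_cases y <;> simp_all [coreEdge]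
  · rw [show coreEdge n y = 2 * n + (y - 2) by grind [coreEdge]]
    exact kmDiagram_meridian_left_half b n (by omega) (by omega)

end KmMeridian

theorem mainTheorem3 (t : ℤ) :
    (Km t).bracket = C ((Int.negOnePow t : ℤˣ) : ℤ) * T (3 * t) ∧
      (Km t).normalizedBracket = 1 ∧
      Nonempty ((Km t).fundamentalGroup ≃* Multiplicative ℤ) := by
  refine ⟨Km_bracket t, ?_, ?_⟩
  · rw [VirtualKnotDiagram.normalizedBracket, Km_bracket, Km_writhe, mul_mul_mul_comm, ← map_mul,
      ← T_add, ← Units.val_mul, Int.units_mul_self]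
    simp
  · refine VirtualKnotDiagram.nonempty_fundamentalGroup_mulEquiv_int fun x hx => ?_
    exact kmDiagram_meridian_eq _ _ (hx.trans_eq (length_kmWord _ _))
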